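/- For $x\in\mathbb{R}$ let $\|x\|=\min\{|x-m|:m\in\mathbb{Z}\}$ denote the distance from $x$ to the nearest integer. Let $\alpha$ be an irrational real number that is not a Liouville number, and let $0<v<1$. Then there exist real constants $r$, $C_1$ and $N_0$, depending only on $\alpha$ and $v$, with $0<r<1$, $0<C_1<1$ and $N_0>1$, such that for every $\gamma\in\mathbb{R}$ and every real $N>N_0$, $$ \sum_{\substack{n\in\mathbb{N}\\ rN<n\le N \\ \|n\alpha-\gamma\|\ge N^{-v}}}\frac{1}{\|n\alpha-\gamma\|} \ \ge\ C_1 N\log N . $$ (An irrational $\alpha$ is a Liouville number if $\liminf_{n\to\infty} n^{w}\|n\alpha\|=0$ for every $w>0$.) -/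

import Mathlib

/-- The distance `‖x‖ = min {|x - m| : m ∈ ℤ}` from a real number `x` to the nearest integer. -/
noncomputable def distNearestInt (x : ℝ) : ℝ := |x - round x|

/-- `distNearestInt x` is the minimum of `|x - m|` over all integers `m`. -/
theorem distNearestInt_isLeast (x : ℝ) :
    IsLeast (Set.range fun m : ℤ => |x - m|) (distNearestInt x) :=
  ⟨⟨round x, rfl⟩, by rintro _ ⟨m, rfl⟩; exact round_le x m⟩

/-!
The sequence `nα - γ` is evenly spread modulo `1` along blocks of `q` consecutive integers, whenever
`p / q` is a reduced fraction with `|α - p / q| < 1 / q ^ 2`: up to an error of size `1 / q` its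
values are a translate of the grid `ℤ / q`. So for each `1 ≤ i ≤ q - 4` there is a separate `n` in
the block with `nα - γ` in `[i / q, (i + 3) / q]` modulo `1`. It satisfies
`1 / q ≤ ‖nα - γ‖ ≤ 4 i / q`, and the harmonic sum over `i` gives a contribution `≫ q log q` of the
block, uniformly in `γ` (`mul_log_le_sum_block`).

Dirichlet's theorem with denominators at most `N ^ v` yields such a fraction with `q ≤ N ^ v`, so
that `1 / q ≥ N ^ (-v)` and all these `n` meet the cut-off of the sum. As `α` is not a Liouville
number, `N ^ v < q ^ A` for a fixed exponent `A` (`add_one_le_den_pow_of_approx`), hence `log q ≫ log N`.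
Since `q ≤ N / 8`, disjoint blocks cover a positive proportion of `(N / 2, N]`, and adding their
contributions gives `≫ N log N`.
-/

theorem distNearestInt_le (x : ℝ) (m : ℤ) : distNearestInt x ≤ |x - m| := round_le x m

theorem distNearestInt_nonneg (x : ℝ) : 0 ≤ distNearestInt x := abs_nonneg _

/-- A number whose distance to `m` on the right is between `δ` and `1 - δ` has distance at least `δ`
to every integer. -/
theorem le_distNearestInt {x δ : ℝ} {m : ℤ} (h₁ : m + δ ≤ x) (h₂ : x ≤ m + 1 - δ) :
    δ ≤ distNearestInt x := by
  unfold distNearestInt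
  rcases le_or_gt (round x) m with h | h
  · have : (round x : ℝ) ≤ m := by exact_mod_cast h
    exact le_trans (by linarith) (le_abs_self _)
  · have : (m : ℝ) + 1 ≤ round x := by exact_mod_cast h
    exact le_trans (by linarith) (neg_le_abs _)

/-- The reciprocal of the distance to the nearest integer, replaced by `0` where this distance is
less than `δ`. -/
noncomputable def truncInvDist (δ x : ℝ) : ℝ :=
  if δ ≤ distNearestInt x then 1 / distNearestInt x else 0

theorem truncInvDist_nonneg (δ x : ℝ) : 0 ≤ truncInvDist δ x := by
  unfold truncInvDist
  split_ifs
  · exact one_div_nonneg.mpr (distNearestInt_nonneg x)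
  · exact le_rfl

/-- If `x / q` is a reduced fraction close to `α`, then `jα + y` with `0 ≤ j < q` comes within
`2 / q` of each prescribed point of the grid `ℤ / q` modulo `1`. The index `j` determines the
grid point modulo `1`, as the congruence for `i` shows. -/
theorem exists_approx_grid_point {α : ℝ} {x : ℚ} (hx : |α - x| < 1 / (x.den : ℝ) ^ 2) (y : ℝ)
    (i : ℕ) :
    ∃ j < x.den, ∃ m : ℤ, (i : ℤ) + 1 = ⌊x.den * y⌋ + j * x.num - x.den * m ∧
      m + (i : ℝ) / x.den ≤ j * α + y ∧ j * α + y ≤ m + (i + 3 : ℝ) / x.den := by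
  have hq : (0 : ℝ) < x.den := by exact_mod_cast x.den_pos
  have hqz : (0 : ℤ) < x.den := by exact_mod_cast x.den_pos
  set s : ℤ := ⌊x.den * y⌋
  -- Solve `s + j p ≡ i + 1` modulo `q` by Bézout.
  obtain ⟨u, w, huw⟩ : IsCoprime x.num (x.den : ℤ) := by
    rw [Int.isCoprime_iff_gcd_eq_one]
    exact x.reduced
  set t : ℤ := u * (i + 1 - s)
  have hj0 : 0 ≤ t % x.den := Int.emod_nonneg _ hqz.ne'
  have hj1 : t % x.den < x.den := Int.emod_lt_of_pos _ hqz
  obtain ⟨j, hj⟩ := Int.eq_ofNat_of_zero_le hj0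
  have hjq : j < x.den := by omega
  have hdiv : t % x.den + x.den * (t / x.den) = t := Int.emod_add_mul_ediv _ _
  have hcong : (i : ℤ) + 1 =
      s + j * x.num - x.den * (-(t / x.den) * x.num - w * (i + 1 - s)) := by
    rw [hj] at hdiv
    have : (j : ℤ) = u * (i + 1 - s) - x.den * (t / x.den) := by simp only [t] at hdiv ⊢; linarith
    rw [this]
    linear_combination (-(i + 1 - s) : ℤ) * huw
  generalize -(t / x.den) * x.num - w * (i + 1 - s) = m at hcong
  refine ⟨j, hjq, m, hcong, ?_⟩
  have hcong' : (i : ℝ) + 1 = s + j * x.num - x.den * m := by exact_mod_cast hcong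
  have hs0 : (s : ℝ) ≤ x.den * y := Int.floor_le _
  have hs1 : x.den * y < s + 1 := Int.lt_floor_add_one _
  have hxq : (x : ℝ) * x.den = x.num := by exact_mod_cast x.mul_den_eq_num
  have herr : |(x.den * j : ℝ) * (α - x)| ≤ 1 := by
    rw [abs_mul, abs_of_nonneg (by positivity)]
    have hjq' : (j : ℝ) ≤ x.den := by exact_mod_cast hjq.le
    calc (x.den * j : ℝ) * |α - x| ≤ (x.den * x.den) * (1 / (x.den : ℝ) ^ 2) := by gcongr
      _ = 1 := by field_simp
  obtain ⟨he0, he1⟩ := abs_le.mp herr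
  have hmain : x.den * (j * α + y) = x.den * m + (i + 1 - s) + x.den * y
      + (x.den * j : ℝ) * (α - x) := by
    linear_combination (j : ℝ) * hxq - hcong'
  constructor
  · rw [← mul_le_mul_iff_right₀ hq, hmain, mul_add, mul_div_cancel₀ _ hq.ne']
    linarith
  · rw [← mul_le_mul_iff_right₀ hq, hmain, mul_add, mul_div_cancel₀ _ hq.ne']
    linarith

/-- The contribution of a block of `q` consecutive integers, `q` being the denominator of a good
rational approximation to `α`. -/
theorem mul_log_le_sum_block {α : ℝ} {x : ℚ} (hx : |α - x| < 1 / (x.den : ℝ) ^ 2)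
    (hq : 5 ≤ x.den) {δ : ℝ} (hδ : δ ≤ 1 / x.den) (y : ℝ) :
    x.den / 4 * Real.log (x.den - 3) ≤
      ∑ j ∈ Finset.range x.den, truncInvDist δ (j * α + y) := by
  have hq0 : (0 : ℝ) < x.den := by exact_mod_cast x.den_pos
  choose j hjq m hcong hlo hhi using exists_approx_grid_point hx y
  have hinj : Set.InjOn (fun i => j (i + 1)) (Finset.range (x.den - 4)) := by
    intro a ha b hb hab
    simp only [Finset.coe_range, Set.mem_Iio] at ha hb hab
    have h1 := hcong (a + 1)
    have h2 := hcong (b + 1)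
    rw [hab] at h1
    have hmod : (a : ℤ) % x.den = b % x.den := by
      apply Int.ModEq.eq
      rw [Int.modEq_iff_dvd]
      refine ⟨m (a + 1) - m (b + 1), ?_⟩
      push_cast at h1 h2
      linarith
    have := Int.emod_eq_of_lt (a := (a : ℤ)) (b := x.den) (by omega) (by omega)
    have := Int.emod_eq_of_lt (a := (b : ℤ)) (b := x.den) (by omega) (by omega)
    omega
  have hterm : ∀ i ∈ Finset.range (x.den - 4),
      x.den / 4 * ((i : ℝ) + 1)⁻¹ ≤ truncInvDist δ (j (i + 1) * α + y) := by
    intro i hi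
    have hi' : (i : ℝ) + 1 + 4 ≤ x.den := by
      have := Finset.mem_range.mp hi
      exact_mod_cast (by omega : i + 1 + 4 ≤ x.den)
    have h1 := hlo (i + 1)
    have h2 := hhi (i + 1)
    push_cast at h1 h2
    set z := (j (i + 1) : ℝ) * α + y
    have hge : 1 / (x.den : ℝ) ≤ distNearestInt z := by
      apply le_distNearestInt (m := m (i + 1))
      · refine le_trans ?_ h1
        gcongr
        linarith [(Nat.cast_nonneg i : (0 : ℝ) ≤ i)]
      · refine h2.trans ?_
        have : ((i : ℝ) + 1 + 3) / x.den + 1 / x.den ≤ 1 := by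
          rw [← add_div, div_le_one hq0]
          linarith
        linarith
    have hle : distNearestInt z ≤ 4 * (i + 1) / x.den := by
      refine (distNearestInt_le z (m (i + 1))).trans ?_
      have h3 : ((i : ℝ) + 1 + 3) / x.den ≤ 4 * (i + 1) / x.den := by
        gcongr
        linarith [(Nat.cast_nonneg i : (0 : ℝ) ≤ i)]
      have h4 : 0 ≤ ((i : ℝ) + 1) / x.den := by positivity
      rw [abs_of_nonneg] <;> linarith
    have hpos : 0 < distNearestInt z := lt_of_lt_of_le (by positivity) hge
    rw [truncInvDist, if_pos (hδ.trans hge)]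
    calc x.den / 4 * ((i : ℝ) + 1)⁻¹ = 1 / (4 * (i + 1) / x.den) := by field_simp
      _ ≤ 1 / distNearestInt z := one_div_le_one_div_of_le hpos hle
  calc x.den / 4 * Real.log (x.den - 3)
      ≤ x.den / 4 * ∑ i ∈ Finset.range (x.den - 4), ((i : ℝ) + 1)⁻¹ := by
        gcongr
        have h := log_add_one_le_harmonic (x.den - 4)
        have hcast : ((x.den - 4 + 1 : ℕ) : ℝ) = x.den - 3 := by
          rw [show x.den - 4 + 1 = x.den - 3 by omega, Nat.cast_sub (by omega)]
          norm_num
        rw [hcast, harmonic] at h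
        push_cast at h
        exact h
    _ ≤ ∑ i ∈ Finset.range (x.den - 4), truncInvDist δ (j (i + 1) * α + y) := by
        rw [Finset.mul_sum]
        exact Finset.sum_le_sum hterm
    _ = ∑ k ∈ (Finset.range (x.den - 4)).image (fun i => j (i + 1)),
          truncInvDist δ (k * α + y) :=
        (Finset.sum_image (f := fun k : ℕ => truncInvDist δ (k * α + y)) hinj).symm
    _ ≤ ∑ k ∈ Finset.range x.den, truncInvDist δ (k * α + y) := by
        apply Finset.sum_le_sum_of_subset_of_nonneg
        · intro k hk
          obtain ⟨i, -, rfl⟩ := Finset.mem_image.mp hk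
          exact Finset.mem_range.mpr (hjq _)
        · exact fun k _ _ => truncInvDist_nonneg _ _

theorem mul_le_sum_range_mul {f : ℕ → ℝ} {c : ℝ} {q : ℕ}
    (h : ∀ M, c ≤ ∑ j ∈ Finset.range q, f (M + j)) (M K : ℕ) :
    K * c ≤ ∑ j ∈ Finset.range (K * q), f (M + j) := by
  induction K with
  | zero => simp
  | succ K ih =>
    rw [Nat.succ_mul, Finset.sum_range_add]
    have := h (M + K * q)
    simp only [add_assoc] at this
    push_cast
    linarith

/-- The denominators of Dirichlet approximations to a number of finite irrationality exponent
grow at least like a power of the bound `Q`. The bound on `|α - round α|` excludes `x.den = 1`. -/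
theorem add_one_le_den_pow_of_approx {α : ℝ} {A : ℕ}
    (hA : ∀ a b : ℤ, 1 < b → 1 / (b : ℝ) ^ A ≤ |α - a / b|) {Q : ℕ} {x : ℚ}
    (hx : |α - x| ≤ 1 / ((Q + 1) * x.den)) (hQ : 1 / ((Q : ℝ) + 1) < |α - round α|) :
    (Q : ℝ) + 1 ≤ (x.den : ℝ) ^ A := by
  have hq0 : (0 : ℝ) < x.den := by exact_mod_cast x.den_pos
  have hxq : (x : ℝ) = x.num / x.den := by exact_mod_cast x.num_div_den.symm
  rcases Nat.lt_or_ge 1 x.den with h | h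
  · have h1 := hA x.num x.den (by exact_mod_cast h)
    rw [Int.cast_natCast, ← hxq] at h1
    have h2 := h1.trans hx
    rw [one_div_le_one_div (by positivity) (by positivity)] at h2
    have h3 : (1 : ℝ) ≤ x.den := by exact_mod_cast h.le
    exact le_trans (le_mul_of_one_le_right (by positivity) h3) h2
  · have h1 : x.den = 1 := le_antisymm h x.den_pos
    rw [hxq, h1] at hx
    have h2 := round_le α x.num
    simp only [Nat.cast_one, div_one, mul_one] at hx
    linarith

theorem exists_exponent_of_not_liouville {α : ℝ} (hα : Irrational α) (hL : ¬ Liouville α) :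
    ∃ A : ℕ, ∀ a b : ℤ, 1 < b → 1 / (b : ℝ) ^ A ≤ |α - a / b| := by
  unfold Liouville at hL
  push Not at hL
  obtain ⟨A, hA⟩ := hL
  refine ⟨A, fun a b hb => hA a b hb ?_⟩
  intro h
  exact hα ⟨(a : ℚ) / b, by rw [h]; push_cast; rfl⟩

theorem theorem1p7 (α : ℝ) (hα : Irrational α) (hL : ¬ Liouville α)
    (v : ℝ) (hv0 : 0 < v) (hv1 : v < 1) :
    ∃ r C₁ N₀ : ℝ, 0 < r ∧ r < 1 ∧ 0 < C₁ ∧ C₁ < 1 ∧ 1 < N₀ ∧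
      ∀ γ N : ℝ, N₀ < N →
        C₁ * N * Real.log N ≤
          ∑ n ∈ (Finset.Icc 1 ⌊N⌋₊).filter
              (fun n : ℕ => r * N < (n : ℝ) ∧ N ^ (-v) ≤ distNearestInt ((n : ℝ) * α - γ)),
            1 / distNearestInt ((n : ℝ) * α - γ) := by
  obtain ⟨A, hA⟩ := exists_exponent_of_not_liouville hα hL
  have hd : 0 < |α - round α| := abs_pos.mpr (sub_ne_zero.mpr (hα.ne_int _))
  have hlarge : ∀ᶠ N : ℝ in Filter.atTop, (16 : ℝ) ^ A < N ^ v ∧ 1 / |α - round α| < N ^ v ∧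
      1 ≤ N ^ v ∧ 8 ≤ N ^ (1 - v) ∧ 16 ≤ N := by
    have h1 := tendsto_rpow_atTop hv0
    have h2 := tendsto_rpow_atTop (sub_pos.mpr hv1)
    filter_upwards [h1.eventually_gt_atTop ((16 : ℝ) ^ A),
      h1.eventually_gt_atTop (1 / |α - round α|), h1.eventually_ge_atTop 1,
      h2.eventually_ge_atTop 8, Filter.eventually_ge_atTop 16] with N a b c d e
    exact ⟨a, b, c, d, e⟩
  obtain ⟨N₁, hN₁⟩ := Filter.eventually_atTop.mp hlarge
  have hA1 : (0 : ℝ) < A + 1 := by positivity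
  refine ⟨1 / 2, v / (32 * (A + 1)), max N₁ 2, by norm_num, by norm_num, by positivity, ?_,
    lt_of_lt_of_le one_lt_two (le_max_right _ _), ?_⟩
  · rw [div_lt_one (by positivity)]
    linarith [(Nat.cast_nonneg A : (0 : ℝ) ≤ A)]
  intro γ N hN
  obtain ⟨h16, hround, hone, h8, hN16⟩ := hN₁ N ((le_max_left _ _).trans hN.le)
  have hN0 : 0 < N := by linarith
  have hNv : N ^ v ≤ N / 8 := by
    have : N ^ v * N ^ (1 - v) = N := by
      rw [← Real.rpow_add hN0]
      simp
    nlinarith [Real.rpow_pos_of_pos hN0 v]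
  -- Dirichlet approximation with denominators up to `N ^ v`.
  set Q : ℕ := ⌊N ^ v⌋₊
  have hQ0 : 0 < Q := Nat.floor_pos.mpr hone
  have hQle : (Q : ℝ) ≤ N ^ v := Nat.floor_le (by positivity)
  have hQlt : N ^ v < Q + 1 := Nat.lt_floor_add_one _
  obtain ⟨x, hx, hxQ⟩ := Real.exists_rat_abs_sub_le_and_den_le α hQ0
  have hq0 : (0 : ℝ) < x.den := by exact_mod_cast x.den_pos
  have hqQ : (x.den : ℝ) ≤ Q := by exact_mod_cast hxQ
  have hpow : (Q : ℝ) + 1 ≤ (x.den : ℝ) ^ A := by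
    refine add_one_le_den_pow_of_approx hA hx ?_
    rw [one_div_lt (by positivity) hd]
    linarith
  have hq16 : (16 : ℝ) < x.den :=
    lt_of_pow_lt_pow_left₀ A hq0.le (by linarith)
  have hx' : |α - x| < 1 / (x.den : ℝ) ^ 2 := by
    refine lt_of_le_of_lt hx ?_
    rw [sq]
    apply one_div_lt_one_div_of_lt (by positivity)
    gcongr
    linarith
  have hδ : N ^ (-v) ≤ 1 / x.den := by
    rw [Real.rpow_neg hN0.le, ← one_div]
    exact one_div_le_one_div_of_le hq0 (hqQ.trans hQle)
  have hlogN : 0 ≤ Real.log N := Real.log_nonneg (by linarith)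
  have hlogq : v * Real.log N ≤ (A + 1) * Real.log x.den := by
    have h1 : Real.log (N ^ v) ≤ Real.log ((x.den : ℝ) ^ A) :=
      Real.log_le_log (by positivity) (by linarith)
    rw [Real.log_rpow hN0, Real.log_pow] at h1
    linarith [Real.log_nonneg (show (1 : ℝ) ≤ x.den by linarith)]
  have hlogq3 : Real.log x.den ≤ 2 * Real.log (x.den - 3) := by
    rw [← Real.log_rpow (by linarith)]
    apply Real.log_le_log hq0
    rw [Real.rpow_two]
    nlinarith
  have hblock : ∀ M : ℕ, x.den / 8 * (v / (A + 1) * Real.log N) ≤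
      ∑ j ∈ Finset.range x.den, truncInvDist (N ^ (-v)) ((M + j : ℕ) * α - γ) := by
    intro M
    have h := mul_log_le_sum_block hx' (by exact_mod_cast (by linarith : (5 : ℝ) ≤ x.den)) hδ
      (M * α - γ)
    have hc : v / (A + 1) * Real.log N ≤ Real.log x.den := by
      rw [div_mul_eq_mul_div, div_le_iff₀ hA1]
      linarith
    calc x.den / 8 * (v / (A + 1) * Real.log N)
        ≤ x.den / 8 * (2 * Real.log (x.den - 3)) :=
          mul_le_mul_of_nonneg_left (hc.trans hlogq3) (by positivity)
      _ = x.den / 4 * Real.log (x.den - 3) := by ring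
      _ ≤ _ := h
      _ = _ := by
        refine Finset.sum_congr rfl fun j _ => ?_
        congr 1
        push_cast
        ring
  -- `K` blocks fit between `M = ⌊N / 2⌋ + 1` and `⌊N⌋`.
  set M : ℕ := ⌊N / 2⌋₊ + 1
  set K : ℕ := (⌊N⌋₊ - ⌊N / 2⌋₊) / x.den
  have hfl : ⌊N / 2⌋₊ ≤ ⌊N⌋₊ := Nat.floor_le_floor (by linarith)
  have hKle : K * x.den ≤ ⌊N⌋₊ - ⌊N / 2⌋₊ := Nat.div_mul_le_self _ _
  have hKge : N / 4 ≤ K * x.den := by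
    have h1 : ⌊N⌋₊ - ⌊N / 2⌋₊ < K * x.den + x.den := Nat.lt_div_mul_add x.den_pos
    have h2 : (⌊N⌋₊ : ℝ) - ⌊N / 2⌋₊ < K * x.den + x.den := by
      rw [← Nat.cast_sub hfl]
      exact_mod_cast h1
    have h3 := Nat.lt_floor_add_one N
    have h4 := Nat.floor_le (show 0 ≤ N / 2 by linarith)
    linarith
  calc v / (32 * (A + 1)) * N * Real.log N
      = (N / 4) * (1 / 8 * (v / (A + 1) * Real.log N)) := by field_simp; ring
    _ ≤ (K * x.den) * (1 / 8 * (v / (A + 1) * Real.log N)) := by gcongr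
    _ = K * (x.den / 8 * (v / (A + 1) * Real.log N)) := by ring
    _ ≤ ∑ j ∈ Finset.range (K * x.den), truncInvDist (N ^ (-v)) ((M + j : ℕ) * α - γ) :=
        mul_le_sum_range_mul (f := fun n => truncInvDist (N ^ (-v)) ((n : ℕ) * α - γ)) hblock M K
    _ = ∑ n ∈ Finset.Ico M (M + K * x.den), truncInvDist (N ^ (-v)) (n * α - γ) := by
        rw [Finset.sum_Ico_eq_sum_range, Nat.add_sub_cancel_left]
    _ ≤ ∑ n ∈ (Finset.Icc 1 ⌊N⌋₊).filter (fun n : ℕ => 1 / 2 * N < (n : ℝ)),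
          truncInvDist (N ^ (-v)) (n * α - γ) := by
        apply Finset.sum_le_sum_of_subset_of_nonneg
        · intro n hn
          rw [Finset.mem_Ico] at hn
          rw [Finset.mem_filter, Finset.mem_Icc]
          refine ⟨⟨by omega, by omega⟩, ?_⟩
          have := (Nat.floor_lt (show 0 ≤ N / 2 by linarith)).mp
            (show ⌊N / 2⌋₊ < n by omega)
          linarith
        · exact fun n _ _ => truncInvDist_nonneg _ _
    _ = _ := by
        rw [← Finset.filter_filter]
        exact (Finset.sum_filter _ _).symm
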